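/- Let $T$ be a finite tree on $n$ vertices. For an edge $e=uv$ of $T$ let $n_u(e)$ and $n_v(e)$ be the numbers of vertices of the components of $T-e$ containing $u$ and $v$ respectively, and put $\mu(e)=\min\{n_u(e),n_v(e)\}$. For $1\le i\le\lfloor n/2\rfloor$ let $r_i(T)$ be the number of edges $e$ of $T$ with $\mu(e)=i$, and let $\mathbf r(T)=(r_1(T),\ldots,r_{\lfloor n/2\rfloor}(T))$ be the edge division vector of $T$. For trees $T,T'$ on $n$ vertices write $T\preceq T'$ if $\sum_{i=k}^{\lfloor n/2\rfloor} r_i(T)\le\sum_{i=k}^{\lfloor n/2\rfloor} r_i(T')$ for every $k=1,\ldots,\lfloor n/2\rfloor$, and $T\approx T'$ if $\mathbf r(T)=\mathbf r(T')$. Let $\mathcal T_n(q)$ be the set of trees on $n$ vertices with exactly $q$ pendent vertices (vertices of degree $1$). For $q\le n-2$ let $CP_{n;\lfloor q/2\rfloor,\lceil q/2\rceil}$ be the graph obtained from the path $P_{n-q}=v_1v_2\cdots v_{n-q}$ by attaching $\lfloor q/2\rfloor$ pendent vertices to $v_1$ and $\lceil q/2\rceil$ pendent vertices to $v_{n-q}$.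 **Theorem.** Let $2<q<n-1$. Then $CP_{n;\lfloor q/2\rfloor,\lceil q/2\rceil}\in\mathcal T_n(q)$, and every $T\in\mathcal T_n(q)$ satisfies $$T\preceq CP_{n;\lfloor q/2\rfloor,\lceil q/2\rceil},$$ with equality, i.e. $T\approx CP_{n;\lfloor q/2\rfloor,\lceil q/2\rceil}$, if and only if $T$ is isomorphic to $CP_{n;\lfloor q/2\rfloor,\lceil q/2\rceil}$. -/

import Mathlib

/-- `v` is a pendent vertex of `G`: it has degree `1`. -/
def IsPendent {V : Type*} (G : SimpleGraph V) (v : V) : Prop :=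
  (G.neighborSet v).ncard = 1

/-- `T` belongs to `𝒯ₙ(q)`: it is a (finite) tree with `n` vertices, exactly `q` of them pendent. -/
structure IsTreeWithPendents {V : Type*} (n q : ℕ) (T : SimpleGraph V) : Prop where
  finite : Finite V
  isTree : T.IsTree
  card_vertices : Nat.card V = n
  card_pendent : {v : V | IsPendent T v}.ncard = q

/-- `n_u(e)` for the edge `e = uv`: the number of vertices of the component of `T - e`
containing `u`. -/
noncomputable def sideCard {V : Type*} (T : SimpleGraph V) (u v : V) : ℕ :=
  {w : V | (T.deleteEdges {s(u, v)}).Reachable u w}.ncard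

/-- `μ(e) = min {n_u(e), n_v(e)}` for `e = uv`. -/
noncomputable def edgeMu {V : Type*} (T : SimpleGraph V) (e : Sym2 V) : ℕ :=
  Sym2.lift ⟨fun u v => min (sideCard T u v) (sideCard T v u), fun _ _ => min_comm _ _⟩ e

/-- `r_i(T)`: the number of edges `e` of `T` with `μ(e) = i`. -/
noncomputable def edgeDivision {V : Type*} (T : SimpleGraph V) (i : ℕ) : ℕ :=
  {e : Sym2 V | e ∈ T.edgeSet ∧ edgeMu T e = i}.ncard

/-- The relation `T ⪯ T'` between trees on `n` vertices: for all `1 ≤ k ≤ ⌊n/2⌋`,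
`∑_{i=k}^{⌊n/2⌋} r_i(T) ≤ ∑_{i=k}^{⌊n/2⌋} r_i(T')`. -/
def EdgeDivisionLE {V W : Type*} (n : ℕ) (T : SimpleGraph V) (T' : SimpleGraph W) : Prop :=
  ∀ k ∈ Finset.Icc 1 (n / 2),
    ∑ i ∈ Finset.Icc k (n / 2), edgeDivision T i ≤ ∑ i ∈ Finset.Icc k (n / 2), edgeDivision T' i

/-- The relation `T ≈ T'` between trees on `n` vertices: the edge division vectors
`(r_1, …, r_{⌊n/2⌋})` of `T` and `T'` coincide. -/
def EdgeDivisionEq {V W : Type*} (n : ℕ) (T : SimpleGraph V) (T' : SimpleGraph W) : Prop :=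
  ∀ i ∈ Finset.Icc 1 (n / 2), edgeDivision T i = edgeDivision T' i

/-- Adjacency of the double star path: the vertices `Sum.inl i` form the path `v_1 ⋯ v_k`
(`v_{i+1}` is `Sum.inl i`), the `a` vertices `Sum.inr (Sum.inl x)` are attached to `v_1` and the
`b` vertices `Sum.inr (Sum.inr y)` are attached to `v_k`. -/
def DoubleStarPathAdj (k a b : ℕ) : Fin k ⊕ (Fin a ⊕ Fin b) → Fin k ⊕ (Fin a ⊕ Fin b) → Prop
  | Sum.inl i, Sum.inl j => i.val + 1 = j.val ∨ j.val + 1 = i.val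
  | Sum.inl i, Sum.inr (Sum.inl _) => i.val = 0
  | Sum.inr (Sum.inl _), Sum.inl i => i.val = 0
  | Sum.inl i, Sum.inr (Sum.inr _) => i.val + 1 = k
  | Sum.inr (Sum.inr _), Sum.inl i => i.val + 1 = k
  | Sum.inr _, Sum.inr _ => False

/-- The double star path `CP_{n;a,b}` with `n = k + a + b`: the path `P_k = v_1 ⋯ v_k` with `a`
pendent vertices attached to `v_1` and `b` pendent vertices attached to `v_k`. -/
def doubleStarPath (k a b : ℕ) : SimpleGraph (Fin k ⊕ (Fin a ⊕ Fin b)) where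
  Adj := DoubleStarPathAdj k a b
  symm := by
    constructor
    rintro (i | x | x) (j | y | y) h <;> simp only [DoubleStarPathAdj] at h ⊢ <;> tauto
  loopless := by
    constructor
    rintro (i | x | x) h <;> simp [DoubleStarPathAdj] at h

/-!
Call an edge `e` of a tree `T` on `n` vertices *`k`-heavy* if `k ≤ μ(e)`. The sums compared by `⪯`
count the `k`-heavy edges, so each of them has to be bounded.

The `2`-heavy edges are those not incident with a pendent vertex, so `T` with `q` pendent vertices
has exactly `n - 1 - q` of them, and at most that many `k`-heavy edges for `k ≥ 2`. On the other
hand, going outwards from a `k`-heavy edge in both directions, the last `k`-heavy edges cut off two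
disjoint components with at least `k` vertices each; the edges inside them, at least `2 (k - 1)` in
number, are not `k`-heavy, so at most `n + 1 - 2 k` edges are. On the double star path with
`a = ⌊q / 2⌋` and `b = ⌈q / 2⌉` the number of `k`-heavy edges is the smaller of these two bounds.

In the case of equality every `2`-heavy edge is `(a + 1)`-heavy, so the two components cut off by
outermost `2`-heavy edges, which are stars, carry at least `a` pendent vertices each. If
`b = a + 1`, only one edge has `μ = a + 1`, which gives a further pendent vertex to one of the two.
All pendent vertices are then adjacent to the centres of the two stars, and every other vertex must
lie on the path between the centres.
-/

open SimpleGraph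

section Pendent

variable {V : Type*} {T : SimpleGraph V}

theorem isPendent_iff_existsUnique {v : V} : IsPendent T v ↔ ∃! w, T.Adj v w := by
  simp only [IsPendent, Set.ncard_eq_one, Set.ext_iff, mem_neighborSet, Set.mem_singleton_iff,
    ExistsUnique]
  exact exists_congr fun w =>
    ⟨fun h => ⟨(h w).2 rfl, fun x => (h x).1⟩, fun h x => ⟨h.2 x, fun hx => hx ▸ h.1⟩⟩

theorem IsPendent.eq_of_adj {u v w : V} (hu : IsPendent T u) (hv : T.Adj u v) (hw : T.Adj u w) :
    v = w :=
  (isPendent_iff_existsUnique.1 hu).unique hv hw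

end Pendent

namespace EdgeDivision

variable {V W : Type*} {T : SimpleGraph V} {T' : SimpleGraph W} {u v w x y : V} {k m n : ℕ}

/-! ### The two sides of an edge -/

/-- The vertex set of the component of `T - uv` containing `u`; its cardinality is
`sideCard T u v`, that is `n_u(uv)`. -/
def side (T : SimpleGraph V) (u v : V) : Set V :=
  {w : V | (T.deleteEdges {s(u, v)}).Reachable u w}

theorem edgeMu_mk (T : SimpleGraph V) (u v : V) :
    edgeMu T s(u, v) = min (side T u v).ncard (side T v u).ncard := rfl

theorem left_mem_side (T : SimpleGraph V) (u v : V) : u ∈ side T u v := Reachable.refl _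

theorem mem_side_of_adj (hx : x ∈ side T u v) (hxy : T.Adj x y) (hne : s(x, y) ≠ s(u, v)) :
    y ∈ side T u v :=
  Reachable.trans hx (Adj.reachable (deleteEdges_adj.2 ⟨hxy, by simpa using hne⟩))

theorem side_subset_of_closed {S : Set V} (hu : u ∈ S)
    (hS : ∀ x y, T.Adj x y → s(x, y) ≠ s(u, v) → x ∈ S → y ∈ S) : side T u v ⊆ S := by
  rintro w ⟨p⟩
  by_contra hw
  obtain ⟨d, -, hfst, hsnd⟩ := p.exists_boundary_dart S hu hw
  obtain ⟨hadj, hne⟩ := deleteEdges_adj.1 d.adj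
  exact hsnd (hS _ _ hadj (by simpa using hne) hfst)

theorem right_notMem_side (hT : T.IsAcyclic) (h : T.Adj u v) : v ∉ side T u v :=
  isBridge_iff.1 (isAcyclic_iff_forall_adj_isBridge.1 hT h)

theorem eq_of_adj_of_mem_side_of_notMem (hT : T.IsAcyclic) (h : T.Adj u v) (hxy : T.Adj x y)
    (hx : x ∈ side T u v) (hy : y ∉ side T u v) : x = u ∧ y = v := by
  by_cases hne : s(x, y) = s(u, v)
  · rcases Sym2.eq_iff.1 hne with hxy | ⟨rfl, -⟩
    · exact hxy
    · exact absurd hx (right_notMem_side hT h)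
  · exact absurd (mem_side_of_adj hx hxy hne) hy

theorem disjoint_side_swap (hT : T.IsAcyclic) (h : T.Adj u v) :
    Disjoint (side T u v) (side T v u) := by
  refine Set.disjoint_left.2 fun w hu hv => right_notMem_side hT h ?_
  rw [side, Sym2.eq_swap] at hv
  exact Reachable.trans hu (Reachable.symm hv)

theorem side_union_side_swap (hT : T.Connected) (u v : V) :
    side T u v ∪ side T v u = Set.univ := by
  refine Set.eq_univ_of_forall fun w => ?_
  by_contra hw
  obtain ⟨d, -, hfst, hsnd⟩ := (hT.preconnected u w).some.exists_boundary_dart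
    (side T u v ∪ side T v u) (Or.inl (left_mem_side T u v)) hw
  apply hsnd
  by_cases he : s(d.fst, d.snd) = s(u, v)
  · rcases Sym2.eq_iff.1 he with ⟨-, h⟩ | ⟨-, h⟩
    · exact Or.inr (h ▸ left_mem_side T v u)
    · exact Or.inl (h ▸ left_mem_side T u v)
  · exact hfst.imp (mem_side_of_adj · d.adj he)
      (mem_side_of_adj · d.adj (by rwa [Sym2.eq_swap (a := v)]))

theorem compl_side (hT : T.IsTree) (h : T.Adj u v) : (side T u v)ᶜ = side T v u :=
  IsCompl.compl_eq ⟨disjoint_side_swap hT.isAcyclic h,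
    codisjoint_iff.2 (side_union_side_swap hT.connected u v)⟩

theorem side_eq_of_cut (hT : T.IsTree) (h : T.Adj u v) {S : Set V} (hu : u ∈ S) (hv : v ∉ S)
    (hS : ∀ x y, T.Adj x y → x ∈ S → y ∉ S → s(x, y) = s(u, v)) : side T u v = S := by
  apply Set.Subset.antisymm
  · refine side_subset_of_closed hu fun x y hxy hne hx => ?_
    by_contra hy
    exact hne (hS x y hxy hx hy)
  · rw [← Set.compl_subset_compl, compl_side hT h]
    refine side_subset_of_closed hv fun x y hxy hne hx hy => hne ?_
    rw [Sym2.eq_swap, hS y x hxy.symm hy hx, Sym2.eq_swap]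

theorem side_ssubset_of_notMem (hT : T.IsAcyclic) (h : T.Adj u v) (hxy : T.Adj x y)
    (hx : x ∈ side T u v) (hy : y ∈ side T u v) (hv : v ∉ side T x y) :
    side T x y ⊂ side T u v := by
  have hsub : side T x y ⊆ side T u v ∩ side T x y := by
    refine side_subset_of_closed ⟨hx, left_mem_side T x y⟩ fun a b hab hne ha => ?_
    have hb := mem_side_of_adj ha.2 hab hne
    refine ⟨?_, hb⟩
    by_contra hbu
    exact hv ((eq_of_adj_of_mem_side_of_notMem hT h hab ha.1 hbu).2 ▸ hb)
  exact ⟨fun w hw => (hsub hw).1, fun hle => right_notMem_side hT hxy (hle hy)⟩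

theorem side_ssubset_or_side_swap_ssubset (hT : T.IsAcyclic) (h : T.Adj u v) (hxy : T.Adj x y)
    (hx : x ∈ side T u v) (hy : y ∈ side T u v) :
    side T x y ⊂ side T u v ∨ side T y x ⊂ side T u v := by
  by_cases hv : v ∈ side T x y
  · exact Or.inr (side_ssubset_of_notMem hT h hxy.symm hy hx
      (Set.disjoint_left.1 (disjoint_side_swap hT hxy) hv))
  · exact Or.inl (side_ssubset_of_notMem hT h hxy hx hy hv)

theorem disjoint_side_of_ne (hT : T.IsAcyclic) (hx : T.Adj x w) (hy : T.Adj y w) (hxy : x ≠ y) :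
    Disjoint (side T x w) (side T y w) := by
  have hsub : side T y w ⊆ (side T x w)ᶜ ∩ side T y w := by
    refine side_subset_of_closed ⟨fun h => hxy ?_, left_mem_side T y w⟩ fun c d hcd hne hc => ?_
    · exact (eq_of_adj_of_mem_side_of_notMem hT hx hy h (right_notMem_side hT hx)).1.symm
    · have hd := mem_side_of_adj hc.2 hcd hne
      refine ⟨fun h => right_notMem_side hT hy ?_, hd⟩
      exact (eq_of_adj_of_mem_side_of_notMem hT hx hcd.symm h hc.1).2 ▸ hc.2
  exact Set.disjoint_right.2 fun c hc => (hsub hc).1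

theorem mem_support_of_mem_side_of_notMem (hT : T.IsAcyclic) (h : T.Adj y w) (p : T.Walk u x)
    (hu : u ∈ side T y w) (hx : x ∉ side T y w) : w ∈ p.support := by
  obtain ⟨d, hd, hfst, hsnd⟩ := p.exists_boundary_dart _ hu hx
  rw [← (eq_of_adj_of_mem_side_of_notMem hT h d.adj hfst hsnd).2]
  exact p.dart_snd_mem_support_of_mem_darts hd

theorem one_le_ncard_side [Finite V] (T : SimpleGraph V) (u v : V) : 1 ≤ (side T u v).ncard :=
  (Set.ncard_pos (Set.toFinite _)).2 ⟨u, left_mem_side T u v⟩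

theorem ncard_side_add_ncard_side_swap [Finite V] (hT : T.IsTree) (h : T.Adj u v) :
    (side T u v).ncard + (side T v u).ncard = Nat.card V := by
  rw [← compl_side hT h, Set.ncard_add_ncard_compl]

theorem connected_induce_side (T : SimpleGraph V) (u v : V) :
    (T.induce (side T u v)).Connected := by
  let C := (T.deleteEdges {s(u, v)}).connectedComponentMk u
  have hC : C.supp = side T u v := by
    ext w
    rw [ConnectedComponent.mem_supp_iff, ConnectedComponent.eq, reachable_comm]
    rfl
  rw [← hC]
  exact C.connected_toSimpleGraph.mono (comap_monotone _ (deleteEdges_le _))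

theorem ncard_le_ncard_edgeSet_inter_sym2_add_one [Finite V] {S : Set V}
    (hS : (T.induce S).Connected) : S.ncard ≤ (T.edgeSet ∩ S.sym2).ncard + 1 := by
  refine hS.card_vert_le_card_edgeSet_add_one.trans (Nat.add_le_add_right ?_ 1)
  rw [Nat.card_coe_set_eq]
  refine Set.ncard_le_ncard_of_injOn (Sym2.map Subtype.val) ?_
    (Sym2.map.injective Subtype.val_injective).injOn (Set.toFinite _)
  intro e he
  induction e using Sym2.ind with
  | _ a b => exact ⟨he, a.2, b.2⟩

theorem ncard_edgeSet_add_one [Finite V] (hT : T.IsTree) : T.edgeSet.ncard + 1 = Nat.card V :=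
  (isTree_iff_connected_and_card.1 hT).2

theorem one_le_edgeMu [Finite V] (T : SimpleGraph V) (e : Sym2 V) : 1 ≤ edgeMu T e := by
  induction e using Sym2.ind with
  | _ u v => exact le_min (one_le_ncard_side T u v) (one_le_ncard_side T v u)

theorem edgeMu_le_half [Finite V] (hT : T.IsTree) {e : Sym2 V} (he : e ∈ T.edgeSet) :
    edgeMu T e ≤ Nat.card V / 2 := by
  induction e using Sym2.ind with
  | _ u v =>
    have := ncard_side_add_ncard_side_swap (u := u) (v := v) hT he
    rw [edgeMu_mk]
    omega

/-! ### Heavy edges -/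

/-- The edges `e` of `T` with `k ≤ μ(e)`. In a tree on `n` vertices there are
`r_k + ⋯ + r_{⌊n/2⌋}` of them, so that `⪯` and `≈` compare their numbers. -/
def heavyEdges (T : SimpleGraph V) (k : ℕ) : Set (Sym2 V) :=
  {e | e ∈ T.edgeSet ∧ k ≤ edgeMu T e}

theorem heavyEdges_anti (T : SimpleGraph V) : Antitone (heavyEdges T) :=
  fun _ _ h _ he => ⟨he.1, h.trans he.2⟩

theorem heavyEdges_one [Finite V] (T : SimpleGraph V) : heavyEdges T 1 = T.edgeSet :=
  Set.ext fun e => ⟨And.left, fun h => ⟨h, one_le_edgeMu T e⟩⟩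

theorem heavyEdges_eq_empty [Finite V] (hT : T.IsTree) (hk : Nat.card V / 2 < k) :
    heavyEdges T k = ∅ :=
  Set.eq_empty_of_forall_notMem fun _ he => (he.2.trans (edgeMu_le_half hT he.1)).not_gt hk

theorem ncard_heavyEdges_eq_add [Finite V] (T : SimpleGraph V) (k : ℕ) :
    (heavyEdges T k).ncard = edgeDivision T k + (heavyEdges T (k + 1)).ncard := by
  have hunion : heavyEdges T k =
      {e | e ∈ T.edgeSet ∧ edgeMu T e = k} ∪ heavyEdges T (k + 1) := by
    ext e
    simp only [heavyEdges, Set.mem_ofPred_eq, Set.mem_union, ← and_or_left]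
    exact and_congr_right fun _ => by omega
  rw [hunion, edgeDivision]
  refine Set.ncard_union_eq (Set.disjoint_left.2 ?_) (Set.toFinite _) (Set.toFinite _)
  rintro e ⟨-, heq⟩ ⟨-, hlt⟩
  omega

theorem sum_Ico_edgeDivision_add [Finite V] (T : SimpleGraph V) (hkm : k ≤ m) :
    ∑ i ∈ Finset.Ico k m, edgeDivision T i + (heavyEdges T m).ncard = (heavyEdges T k).ncard := by
  induction m, hkm using Nat.le_induction with
  | base => simp
  | succ m hkm ih =>
    rw [Finset.sum_Ico_succ_top hkm, add_assoc, ← ncard_heavyEdges_eq_add, ih]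

theorem sum_edgeDivision [Finite V] (hT : T.IsTree) (k : ℕ) :
    ∑ i ∈ Finset.Icc k (Nat.card V / 2), edgeDivision T i = (heavyEdges T k).ncard := by
  rcases le_or_gt k (Nat.card V / 2) with hk | hk
  · rw [← sum_Ico_edgeDivision_add T (Nat.le_succ_of_le hk),
      heavyEdges_eq_empty hT (Nat.lt_succ_self _), Set.ncard_empty, add_zero]
    rfl
  · rw [Finset.Icc_eq_empty_of_lt hk, heavyEdges_eq_empty hT hk, Finset.sum_empty,
      Set.ncard_empty]

theorem edgeDivisionLE_iff [Finite V] [Finite W] (hT : T.IsTree) (hT' : T'.IsTree)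
    (hV : Nat.card V = n) (hW : Nat.card W = n) :
    EdgeDivisionLE n T T' ↔
      ∀ k ∈ Finset.Icc 1 (n / 2), (heavyEdges T k).ncard ≤ (heavyEdges T' k).ncard := by
  simp only [EdgeDivisionLE, ← sum_edgeDivision hT, ← sum_edgeDivision hT', hV, hW]

theorem ncard_heavyEdges_eq_of_edgeDivisionEq [Finite V] [Finite W] (hT : T.IsTree)
    (hT' : T'.IsTree) (hV : Nat.card V = n) (hW : Nat.card W = n) (h : EdgeDivisionEq n T T')
    (hk : 1 ≤ k) : (heavyEdges T k).ncard = (heavyEdges T' k).ncard := by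
  rw [← sum_edgeDivision hT, ← sum_edgeDivision hT', hV, hW]
  refine Finset.sum_congr rfl fun i hi => h i ?_
  exact Finset.Icc_subset_Icc_left hk hi

/-- A heavy edge `uv` that is outermost on the side of `u`: no edge of the component of `T - uv`
containing `u` satisfies `k ≤ μ`. -/
structure IsOutermostHeavy (T : SimpleGraph V) (k : ℕ) (u v : V) : Prop where
  adj : T.Adj u v
  le_edgeMu : k ≤ edgeMu T s(u, v)
  disjoint : Disjoint (heavyEdges T k) (side T u v).sym2

theorem IsOutermostHeavy.le_ncard_side (h : IsOutermostHeavy T k u v) :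
    k ≤ (side T u v).ncard :=
  h.le_edgeMu.trans (min_le_left _ _)

theorem exists_isOutermostHeavy_side_subset [Finite V] (hT : T.IsAcyclic) (h : T.Adj u v)
    (hk : k ≤ edgeMu T s(u, v)) :
    ∃ x y, IsOutermostHeavy T k x y ∧ side T x y ⊆ side T u v := by
  induction hN : (side T u v).ncard using Nat.strong_induction_on generalizing u v with
  | _ N ih =>
    have descend {x y : V} (hxy : T.Adj x y) (hkxy : k ≤ edgeMu T s(x, y))
        (hss : side T x y ⊂ side T u v) :
        ∃ x y, IsOutermostHeavy T k x y ∧ side T x y ⊆ side T u v := by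
      obtain ⟨x', y', hout, hsub⟩ := ih _ (hN ▸ Set.ncard_lt_ncard hss) hxy hkxy rfl
      exact ⟨x', y', hout, hsub.trans hss.1⟩
    by_cases hd : Disjoint (heavyEdges T k) (side T u v).sym2
    · exact ⟨u, v, ⟨h, hk, hd⟩, subset_rfl⟩
    obtain ⟨e, ⟨hadj, hke⟩, hmem⟩ := Set.not_disjoint_iff.1 hd
    induction e using Sym2.ind with
    | _ x y =>
      rcases side_ssubset_or_side_swap_ssubset hT h hadj hmem.1 hmem.2 with hss | hss
      · exact descend hadj hke hss
      · exact descend (Adj.symm hadj) (by rwa [Sym2.eq_swap]) hss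

theorem exists_isOutermostHeavy_pair [Finite V] (hT : T.IsAcyclic)
    (hne : (heavyEdges T k).Nonempty) :
    ∃ u v x y, IsOutermostHeavy T k u v ∧ IsOutermostHeavy T k x y ∧
      Disjoint (side T u v) (side T x y) := by
  obtain ⟨e, hadj, hke⟩ := hne
  induction e using Sym2.ind with
  | _ c d =>
    obtain ⟨u, v, huv, hc⟩ := exists_isOutermostHeavy_side_subset hT hadj hke
    obtain ⟨x, y, hxy, hd⟩ := exists_isOutermostHeavy_side_subset (k := k) hT (Adj.symm hadj)
      (by rwa [Sym2.eq_swap])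
    exact ⟨u, v, x, y, huv, hxy, (disjoint_side_swap hT hadj).mono hc hd⟩

theorem ncard_heavyEdges_le [Finite V] (hT : T.IsTree) (k : ℕ) :
    (heavyEdges T k).ncard ≤ Nat.card V + 1 - 2 * k := by
  rcases (heavyEdges T k).eq_empty_or_nonempty with hempty | hne
  · simp [hempty]
  obtain ⟨u, v, x, y, huv, hxy, hdisj⟩ := exists_isOutermostHeavy_pair hT.isAcyclic hne
  have hA := ncard_le_ncard_edgeSet_inter_sym2_add_one (connected_induce_side T u v)
  have hB := ncard_le_ncard_edgeSet_inter_sym2_add_one (connected_induce_side T x y)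
  set A := T.edgeSet ∩ (side T u v).sym2
  set B := T.edgeSet ∩ (side T x y).sym2
  have hAB : Disjoint A B := by
    refine Set.disjoint_left.2 fun e he he' => ?_
    induction e using Sym2.ind with
    | _ c d => exact Set.disjoint_left.1 hdisj he.2.1 he'.2.1
  have hHAB : Disjoint (heavyEdges T k) (A ∪ B) := Set.disjoint_union_right.2
    ⟨huv.disjoint.mono_right Set.inter_subset_right, hxy.disjoint.mono_right Set.inter_subset_right⟩
  have hsub : heavyEdges T k ∪ (A ∪ B) ⊆ T.edgeSet := by
    rintro e (he | he | he) <;> exact he.1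
  have hcard := Set.ncard_le_ncard hsub (Set.toFinite _)
  rw [Set.ncard_union_eq hHAB, Set.ncard_union_eq hAB] at hcard
  have := ncard_edgeSet_add_one hT
  have := huv.le_ncard_side
  have := hxy.le_ncard_side
  omega

/-! ### Pendent vertices and heavy edges -/

theorem isPendent_iff_ncard_side (h : T.Adj u v) : IsPendent T u ↔ (side T u v).ncard = 1 := by
  refine ⟨fun hu => Set.ncard_eq_one.2 ⟨u, ?_⟩, fun hs => ?_⟩
  · refine (side_subset_of_closed (Set.mem_singleton u) ?_).antisymm
      (Set.singleton_subset_iff.2 (left_mem_side T u v))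
    rintro x y hxy hne rfl
    exact absurd (by rw [hu.eq_of_adj hxy h]) hne
  · obtain ⟨z, hz⟩ := Set.ncard_eq_one.1 hs
    obtain rfl : u = z := by simpa [hz] using left_mem_side T u v
    refine isPendent_iff_existsUnique.2 ⟨v, h, fun y hy => ?_⟩
    by_contra hyv
    have hmem : y ∈ side T u v :=
      mem_side_of_adj (left_mem_side T u v) hy (mt Sym2.congr_right.1 hyv)
    exact hy.ne' (by simpa [hz] using hmem)

theorem two_le_edgeMu_iff [Finite V] (h : T.Adj u v) :
    2 ≤ edgeMu T s(u, v) ↔ ¬ IsPendent T u ∧ ¬ IsPendent T v := by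
  rw [isPendent_iff_ncard_side h, isPendent_iff_ncard_side h.symm, edgeMu_mk]
  have := one_le_ncard_side T u v
  have := one_le_ncard_side T v u
  omega

theorem edgeMu_eq_one_iff [Finite V] (h : T.Adj u v) :
    edgeMu T s(u, v) = 1 ↔ IsPendent T u ∨ IsPendent T v := by
  have := one_le_edgeMu T s(u, v)
  rw [← not_iff_not, not_or, ← two_le_edgeMu_iff h]
  omega

theorem exists_isPendent_mem_side [Finite V] (hT : T.IsAcyclic) (h : T.Adj u v) :
    ∃ z ∈ side T u v, IsPendent T z := by
  obtain ⟨x, y, hxy, hsub⟩ := exists_isOutermostHeavy_side_subset hT h (one_le_edgeMu T _)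
  refine ⟨x, hsub (left_mem_side T x y), (isPendent_iff_ncard_side hxy.adj).2 ?_⟩
  have hcard := ncard_le_ncard_edgeSet_inter_sym2_add_one (connected_induce_side T x y)
  rw [← heavyEdges_one, hxy.disjoint.inter_eq, Set.ncard_empty] at hcard
  exact hcard.antisymm (one_le_ncard_side T x y)

theorem not_isPendent_of_isPendent_of_adj [Finite V] (hT : T.IsTree) (hV : 3 ≤ Nat.card V)
    (h : T.Adj u v) (hu : IsPendent T u) : ¬ IsPendent T v := by
  intro hv
  have hadd := ncard_side_add_ncard_side_swap hT h
  rw [(isPendent_iff_ncard_side h).1 hu, (isPendent_iff_ncard_side h.symm).1 hv] at hadd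
  omega

theorem edgeDivision_one [Finite V] (hT : T.IsTree) (hV : 3 ≤ Nat.card V) :
    edgeDivision T 1 = {v | IsPendent T v}.ncard := by
  have : Nontrivial V := Finite.one_lt_card_iff_nontrivial.1 (by omega)
  choose f hf using hT.connected.preconnected.exists_adj_of_nontrivial
  refine (Set.ncard_congr (fun v _ => s(v, f v)) (fun v hv => ?_) (fun a b ha hb hab => ?_)
    fun e he => ?_).symm
  · exact ⟨hf v, (edgeMu_eq_one_iff (hf v)).2 (Or.inl hv)⟩
  · rcases Sym2.eq_iff.1 hab with ⟨h, -⟩ | ⟨-, h⟩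
    · exact h
    · exact absurd hb (not_isPendent_of_isPendent_of_adj hT hV (h ▸ hf a) ha)
  · induction e using Sym2.ind with
    | _ a b =>
      obtain ⟨hadj, hmu⟩ := he
      rcases (edgeMu_eq_one_iff hadj).1 hmu with h | h
      · exact ⟨a, h, by rw [h.eq_of_adj (hf a) hadj]⟩
      · exact ⟨b, h, by rw [h.eq_of_adj (hf b) (Adj.symm hadj), Sym2.eq_swap]⟩

theorem ncard_heavyEdges_two_add [Finite V] (hT : T.IsTree) (hV : 3 ≤ Nat.card V) :
    (heavyEdges T 2).ncard + {v | IsPendent T v}.ncard + 1 = Nat.card V := by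
  rw [← ncard_edgeSet_add_one hT, ← heavyEdges_one, ncard_heavyEdges_eq_add T 1,
    edgeDivision_one hT hV, Nat.add_comm (Set.ncard _)]

/-! ### Invariance under isomorphism -/

theorem side_map_iso (φ : T ≃g T') (u v : V) : side T' (φ u) (φ v) = φ '' side T u v := by
  apply Set.Subset.antisymm
  · refine side_subset_of_closed ⟨u, left_mem_side T u v, rfl⟩ ?_
    rintro _ d hcd hne ⟨c, hc, rfl⟩
    obtain ⟨d, rfl⟩ := φ.surjective d
    refine ⟨d, mem_side_of_adj hc (φ.map_adj_iff.1 hcd) fun h => hne ?_, rfl⟩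
    simpa using congrArg (Sym2.map φ) h
  · rw [Set.image_subset_iff]
    refine side_subset_of_closed (left_mem_side T' _ _) fun c d hcd hne hc => ?_
    refine mem_side_of_adj hc (φ.map_adj_iff.2 hcd) fun h => hne ?_
    exact Sym2.map.injective φ.injective (by simpa using h)

theorem edgeMu_map_iso (φ : T ≃g T') (e : Sym2 V) : edgeMu T' (e.map φ) = edgeMu T e := by
  induction e using Sym2.ind with
  | _ u v =>
    rw [Sym2.map_mk, edgeMu_mk, edgeMu_mk, side_map_iso, side_map_iso,
      Set.ncard_image_of_injective _ φ.injective, Set.ncard_image_of_injective _ φ.injective]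

theorem edgeDivision_eq_of_iso (φ : T ≃g T') (k : ℕ) : edgeDivision T k = edgeDivision T' k := by
  refine Set.ncard_congr (fun e _ => e.map φ) (fun e he => ?_)
    (fun e f _ _ hef => Sym2.map.injective φ.injective hef) fun e he => ⟨e.map φ.symm, ?_, ?_⟩
  · exact ⟨φ.map_mem_edgeSet_iff.2 he.1, (edgeMu_map_iso φ e).trans he.2⟩
  · exact ⟨φ.symm.map_mem_edgeSet_iff.2 he.1, (edgeMu_map_iso φ.symm e).trans he.2⟩
  · simp [Sym2.map_map]

/-! ### The double star path -/

theorem isTree_of_parent [Finite V] (hT : T.Connected) (r : V) (parent : V → V)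
    (h : ∀ u v, T.Adj u v → u ≠ r ∧ parent u = v ∨ v ≠ r ∧ parent v = u) : T.IsTree := by
  refine isTree_iff_connected_and_card.2 ⟨hT, ?_⟩
  refine le_antisymm ?_ hT.card_vert_le_card_edgeSet_add_one
  have hsub : T.edgeSet ⊆ (fun v => s(v, parent v)) '' {r}ᶜ := by
    intro e he
    induction e using Sym2.ind with
    | _ u v =>
      rcases h u v he with ⟨hu, huv⟩ | ⟨hv, hvu⟩
      · exact ⟨u, hu, by simp only [huv]⟩
      · exact ⟨v, hv, by simp only [hvu, Sym2.eq_swap]⟩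
  have hcard := (Set.ncard_le_ncard hsub (Set.toFinite _)).trans
    (Set.ncard_image_le (Set.toFinite _))
  rw [← Set.ncard_add_ncard_compl {r}, Set.ncard_singleton, Nat.card_coe_set_eq]
  omega

variable {a b : ℕ}

theorem doubleStarPath_adj_castSucc_succ (a b : ℕ) (i : Fin m) :
    (doubleStarPath (m + 1) a b).Adj (.inl i.castSucc) (.inl i.succ) := Or.inl rfl

theorem doubleStarPath_adj_inl_inr_inl {i : Fin k} {s : Fin a} :
    (doubleStarPath k a b).Adj (.inl i) (.inr (.inl s)) ↔ i.val = 0 := Iff.rfl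

theorem doubleStarPath_adj_inl_inr_inr {i : Fin k} {t : Fin b} :
    (doubleStarPath k a b).Adj (.inl i) (.inr (.inr t)) ↔ i.val + 1 = k := Iff.rfl

theorem not_doubleStarPath_adj_inr_inr {s t : Fin a ⊕ Fin b} :
    ¬ (doubleStarPath k a b).Adj (.inr s) (.inr t) := by
  rcases s with s | s <;> exact id

/-- The parent of a vertex of the double star path rooted at the first vertex of its spine; the
value at the root itself is irrelevant. -/
def doubleStarPathParent (m a b : ℕ) :
    Fin (m + 1) ⊕ (Fin a ⊕ Fin b) → Fin (m + 1) ⊕ (Fin a ⊕ Fin b)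
  | .inl i => .inl ⟨i - 1, by omega⟩
  | .inr (.inl _) => .inl 0
  | .inr (.inr _) => .inl (Fin.last m)

theorem connected_doubleStarPath (m a b : ℕ) : (doubleStarPath (m + 1) a b).Connected := by
  have hspine (i : Fin (m + 1)) : (doubleStarPath (m + 1) a b).Reachable (.inl 0) (.inl i) := by
    induction i using Fin.induction with
    | zero => rfl
    | succ i ih => exact ih.trans (doubleStarPath_adj_castSucc_succ a b i).reachable
  refine connected_iff_exists_forall_reachable _ |>.2 ⟨.inl 0, ?_⟩
  rintro (i | s | t)
  · exact hspine i
  · exact (doubleStarPath_adj_inl_inr_inl.2 rfl).reachable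
  · exact (hspine (Fin.last m)).trans (doubleStarPath_adj_inl_inr_inr.2 rfl).reachable

theorem isTree_doubleStarPath (m a b : ℕ) : (doubleStarPath (m + 1) a b).IsTree := by
  refine isTree_of_parent (connected_doubleStarPath m a b) (.inl 0) (doubleStarPathParent m a b) ?_
  rintro (i | s | t) (j | s' | t') h <;>
    simp only [doubleStarPath, DoubleStarPathAdj] at h <;>
    simp only [doubleStarPathParent, ne_eq, Sum.inl.injEq, reduceCtorEq, Fin.ext_iff, Fin.val_zero,
      Fin.val_last, not_false_eq_true, true_and, and_false, or_false, false_or] <;> omega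

theorem natCard_doubleStarPath (k a b : ℕ) :
    Nat.card (Fin k ⊕ (Fin a ⊕ Fin b)) = k + (a + b) := by
  simp

theorem isPendent_doubleStarPath_inr (m : ℕ) (s : Fin a ⊕ Fin b) :
    IsPendent (doubleStarPath (m + 1) a b) (.inr s) := by
  rcases s with s | t
  · refine isPendent_iff_existsUnique.2 ⟨.inl 0, (doubleStarPath_adj_inl_inr_inl.2 rfl).symm, ?_⟩
    rintro (i | s') h
    · exact congrArg Sum.inl (Fin.ext (doubleStarPath_adj_inl_inr_inl.1 h.symm))
    · exact absurd h not_doubleStarPath_adj_inr_inr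
  · refine isPendent_iff_existsUnique.2
      ⟨.inl (Fin.last m), (doubleStarPath_adj_inl_inr_inr.2 rfl).symm, ?_⟩
    rintro (i | s') h
    · have hi := doubleStarPath_adj_inl_inr_inr.1 h.symm
      exact congrArg Sum.inl (Fin.ext (Nat.succ.inj hi))
    · exact absurd h not_doubleStarPath_adj_inr_inr

theorem not_isPendent_doubleStarPath_inl (hm : 1 ≤ m) (ha : 1 ≤ a) (hb : 1 ≤ b)
    (i : Fin (m + 1)) : ¬ IsPendent (doubleStarPath (m + 1) a b) (.inl i) := by
  intro hi
  rcases Fin.eq_zero_or_eq_succ i with rfl | ⟨j, rfl⟩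
  · have hleaf : (doubleStarPath (m + 1) a b).Adj (.inl 0) (.inr (.inl ⟨0, ha⟩)) :=
      doubleStarPath_adj_inl_inr_inl.2 rfl
    have := hi.eq_of_adj hleaf (doubleStarPath_adj_castSucc_succ a b ⟨0, hm⟩)
    simp at this
  have hprev := (doubleStarPath_adj_castSucc_succ a b j).symm
  rcases Fin.eq_castSucc_or_eq_last j.succ with ⟨l, hl⟩ | hlast
  · have hnext := doubleStarPath_adj_castSucc_succ a b l
    rw [← hl] at hnext
    have := hi.eq_of_adj hprev hnext
    simp only [Sum.inl.injEq, Fin.ext_iff, Fin.val_castSucc, Fin.val_succ] at this hl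
    omega
  · have hleaf : (doubleStarPath (m + 1) a b).Adj (.inl j.succ) (.inr (.inr ⟨0, hb⟩)) :=
      doubleStarPath_adj_inl_inr_inr.2 (by rw [hlast, Fin.val_last])
    simpa using hi.eq_of_adj hleaf hprev

theorem isPendent_doubleStarPath_iff (hm : 1 ≤ m) (ha : 1 ≤ a) (hb : 1 ≤ b)
    {v : Fin (m + 1) ⊕ (Fin a ⊕ Fin b)} :
    IsPendent (doubleStarPath (m + 1) a b) v ↔ v ∈ Set.range Sum.inr := by
  rcases v with i | s
  · simpa using not_isPendent_doubleStarPath_inl hm ha hb i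
  · simpa using isPendent_doubleStarPath_inr m s

theorem isTreeWithPendents_doubleStarPath (hm : 1 ≤ m) (ha : 1 ≤ a) (hb : 1 ≤ b) :
    IsTreeWithPendents (m + 1 + (a + b)) (a + b) (doubleStarPath (m + 1) a b) where
  finite := inferInstance
  isTree := isTree_doubleStarPath m a b
  card_vertices := natCard_doubleStarPath (m + 1) a b
  card_pendent := by
    simp only [isPendent_doubleStarPath_iff hm ha hb, Set.ofPred_mem_eq]
    rw [← Set.image_univ, Set.ncard_image_of_injective _ Sum.inr_injective, Set.ncard_univ]
    simp

/-- The edge joining two consecutive vertices of the path underlying the double star path. -/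
def spineEdge (a b : ℕ) (i : Fin m) : Sym2 (Fin (m + 1) ⊕ (Fin a ⊕ Fin b)) :=
  s(.inl i.castSucc, .inl i.succ)

theorem spineEdge_injective : Function.Injective (spineEdge a b (m := m)) := by
  intro i j h
  simp only [spineEdge, Sym2.eq_iff, Sum.inl.injEq, Fin.ext_iff, Fin.val_castSucc,
    Fin.val_succ] at h
  omega

theorem side_castSucc_succ (i : Fin m) :
    side (doubleStarPath (m + 1) a b) (.inl i.castSucc) (.inl i.succ) =
      Sum.inl '' Set.Iic i.castSucc ∪ Sum.inr '' Set.range Sum.inl := by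
  refine side_eq_of_cut (isTree_doubleStarPath m a b) (doubleStarPath_adj_castSucc_succ a b i)
    (by simp) (by simp) ?_
  rintro (c | s | t) (d | s' | t') h <;>
    simp only [doubleStarPath, DoubleStarPathAdj] at h <;>
    simp [Sum.inl_injective.mem_set_image, Fin.ext_iff, Fin.le_def] <;> omega

theorem ncard_side_castSucc_succ (i : Fin m) :
    (side (doubleStarPath (m + 1) a b) (.inl i.castSucc) (.inl i.succ)).ncard = i + 1 + a := by
  rw [side_castSucc_succ, Set.ncard_union_eq (by simp [Set.disjoint_left]),
    Set.ncard_image_of_injective _ Sum.inl_injective,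
    Set.ncard_image_of_injective _ Sum.inr_injective, ← Set.image_univ,
    Set.ncard_image_of_injective _ Sum.inl_injective]
  simp [Set.ncard_eq_toFinset_card']

theorem edgeMu_spineEdge (i : Fin m) :
    edgeMu (doubleStarPath (m + 1) a b) (spineEdge a b i) = min (i + 1 + a) (m - i + b) := by
  have hadd := ncard_side_add_ncard_side_swap (isTree_doubleStarPath m a b)
    (doubleStarPath_adj_castSucc_succ a b i)
  rw [ncard_side_castSucc_succ, natCard_doubleStarPath] at hadd
  rw [spineEdge, edgeMu_mk, ncard_side_castSucc_succ]
  omega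

theorem exists_spineEdge_eq (hm : 1 ≤ m) (ha : 1 ≤ a) (hb : 1 ≤ b)
    {e : Sym2 (Fin (m + 1) ⊕ (Fin a ⊕ Fin b))} (he : e ∈ (doubleStarPath (m + 1) a b).edgeSet)
    (h2 : 2 ≤ edgeMu (doubleStarPath (m + 1) a b) e) : ∃ i, spineEdge a b i = e := by
  induction e using Sym2.ind with
  | _ c d =>
    rw [two_le_edgeMu_iff he, isPendent_doubleStarPath_iff hm ha hb,
      isPendent_doubleStarPath_iff hm ha hb] at h2
    rcases c with c | s
    · rcases d with d | s
      · rcases (he : c.val + 1 = d ∨ d.val + 1 = c) with h | h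
        · refine ⟨⟨c, by omega⟩, ?_⟩
          simp [spineEdge, h]
        · refine ⟨⟨d, by omega⟩, ?_⟩
          simp [spineEdge, h]
      · exact absurd ⟨s, rfl⟩ h2.2
    · exact absurd ⟨s, rfl⟩ h2.1

theorem heavyEdges_doubleStarPath (hm : 1 ≤ m) (ha : 1 ≤ a) (hb : 1 ≤ b) (hk : 2 ≤ k) :
    heavyEdges (doubleStarPath (m + 1) a b) k =
      spineEdge a b '' {i : Fin m | k ≤ i + 1 + a ∧ k ≤ m - i + b} := by
  ext e
  constructor
  · rintro ⟨hadj, hke⟩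
    obtain ⟨i, rfl⟩ := exists_spineEdge_eq hm ha hb hadj (hk.trans hke)
    exact ⟨i, le_min_iff.1 (edgeMu_spineEdge i ▸ hke), rfl⟩
  · rintro ⟨i, hi, rfl⟩
    exact ⟨doubleStarPath_adj_castSucc_succ a b i, edgeMu_spineEdge i ▸ le_min_iff.2 hi⟩

theorem ncard_heavyEdges_doubleStarPath (hm : 1 ≤ m) (ha : 1 ≤ a) (hab : a ≤ b) (hba : b ≤ a + 1)
    (hk : 2 ≤ k) : (heavyEdges (doubleStarPath (m + 1) a b) k).ncard =
      min m (m + (a + b) + 2 - 2 * k) := by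
  rw [heavyEdges_doubleStarPath hm ha (ha.trans hab) hk,
    Set.ncard_image_of_injective _ spineEdge_injective,
    ← Set.ncard_image_of_injective _ Fin.val_injective]
  have himage : Fin.val '' {i : Fin m | k ≤ i + 1 + a ∧ k ≤ m - i + b} =
      Set.Ico (k - 1 - a) (min m (m + b + 1 - k)) := by
    ext i
    simp only [Set.mem_image, Set.mem_ofPred_eq, Set.mem_Ico]
    constructor
    · rintro ⟨i, hi, rfl⟩
      omega
    · intro hi
      exact ⟨⟨i, by omega⟩, by simp only; omega, rfl⟩
  rw [himage, Set.ncard_Ico_nat]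
  omega

/-! ### Trees all of whose pendent vertices hang on two vertices -/

theorem nonempty_iso_of_bijective_hom (hT : T.Connected) (hT' : T'.IsAcyclic) (f : T →g T')
    (hf : Function.Bijective f) : Nonempty (T ≃g T') := by
  refine ⟨⟨Equiv.ofBijective f hf, @fun c d => ⟨fun h => ?_, f.map_adj⟩⟩⟩
  obtain ⟨p, hp⟩ := (hT.preconnected c d).exists_isPath
  have heq := (hT'.subsingleton_path _ _).elim ⟨p.map f, hp.map hf.injective⟩ (Path.singleton h)
  refine Walk.adj_of_length_eq_one (p := p) ?_
  rw [← Walk.length_map f, congrArg (fun q => q.1.length) heq]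
  rfl

/-- The pendent vertices of `T` adjacent to `u`. -/
def pendentNeighbors (T : SimpleGraph V) (u : V) : Set V :=
  {z | IsPendent T z ∧ T.Adj u z}

theorem disjoint_pendentNeighbors (T : SimpleGraph V) (hux : u ≠ x) :
    Disjoint (pendentNeighbors T u) (pendentNeighbors T x) :=
  Set.disjoint_left.2 fun _ hu hx => hux (hu.1.eq_of_adj hu.2.symm hx.2.symm)

theorem exists_mem_side_of_isPendent_subset [Finite V] (hT : T.IsAcyclic)
    (hcover : {z | IsPendent T z} ⊆ pendentNeighbors T u ∪ pendentNeighbors T x)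
    (hw : ¬ IsPendent T w) (hu : u ≠ w) (hx : x ≠ w) (hy : T.Adj y w) :
    u ∈ side T y w ∨ x ∈ side T y w := by
  obtain ⟨z, hz, hpendent⟩ := exists_isPendent_mem_side hT hy
  have mem_side {c : V} (hc : c ≠ w) (hzc : z ∈ pendentNeighbors T c) : c ∈ side T y w := by
    refine mem_side_of_adj hz hzc.2.symm fun h => ?_
    rcases Sym2.eq_iff.1 h with ⟨-, rfl⟩ | ⟨rfl, -⟩
    exacts [hc rfl, hw hpendent]
  exact (hcover hpendent).imp (mem_side hu) (mem_side hx)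

theorem exists_adj_ne_of_not_isPendent (h : T.Adj w y) (hw : ¬ IsPendent T w) :
    ∃ z, T.Adj w z ∧ z ≠ y := by
  by_contra! hunique
  exact hw (isPendent_iff_existsUnique.2 ⟨y, h, hunique⟩)

-- Two branches at `w` each contain a pendent vertex, hence one of them contains `u` and the other
-- one `x`.
theorem mem_support_of_not_isPendent [Finite V] (hT : T.IsTree)
    (hcover : {z | IsPendent T z} ⊆ pendentNeighbors T u ∪ pendentNeighbors T x)
    (hw : ¬ IsPendent T w) (p : T.Walk u x) : w ∈ p.support := by
  rcases eq_or_ne u w with rfl | hu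
  · exact p.start_mem_support
  rcases eq_or_ne x w with rfl | hx
  · exact p.end_mem_support
  have : Nontrivial V := ⟨u, w, hu⟩
  obtain ⟨y, hy⟩ := hT.connected.preconnected.exists_adj_of_nontrivial w
  obtain ⟨z, hz, hzy⟩ := exists_adj_ne_of_not_isPendent hy hw
  have hmem {c : V} (hc : T.Adj w c) :=
    exists_mem_side_of_isPendent_subset hT.isAcyclic hcover hw hu hx hc.symm
  have hdisj := disjoint_side_of_ne hT.isAcyclic hy.symm hz.symm hzy.symm
  by_cases huy : u ∈ side T y w
  · have hxz := (hmem hz).resolve_left (Set.disjoint_left.1 hdisj huy)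
    exact mem_support_of_mem_side_of_notMem hT.isAcyclic hy.symm p huy
      (Set.disjoint_right.1 hdisj hxz)
  · have hxy := (hmem hy).resolve_left huy
    have hxz := Set.disjoint_left.1 hdisj hxy
    exact mem_support_of_mem_side_of_notMem hT.isAcyclic hz.symm p ((hmem hz).resolve_right hxz) hxz

theorem not_isPendent_of_mem_support {p : T.Walk u x} (hp : p.IsPath) (hu : ¬ IsPendent T u)
    (hx : ¬ IsPendent T x) (hw : w ∈ p.support) : ¬ IsPendent T w := by
  obtain ⟨i, rfl, hi⟩ := p.mem_support_iff_exists_getVert.1 hw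
  rcases i with _ | i
  · rwa [p.getVert_zero]
  rcases hi.eq_or_lt with hi | hlt
  · rwa [hi, p.getVert_length]
  intro hpendent
  have hprev := p.adj_getVert_succ (Nat.lt_of_succ_le hi)
  have hnext := p.adj_getVert_succ hlt
  have := hp.getVert_injOn (by simp; omega) (by simp; omega) (hpendent.eq_of_adj hprev.symm hnext)
  omega

section Parametrization

variable (p : T.Walk u x) (f : Fin a ≃ pendentNeighbors T u) (g : Fin b ≃ pendentNeighbors T x)

/-- The homomorphism from a double star path to `T` which runs along the walk `p` and enumerates the
pendent neighbours of its two ends. -/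
def doubleStarPathHom : doubleStarPath (p.length + 1) a b →g T where
  toFun := Sum.elim (fun i => p.getVert i) (Sum.elim (fun s => f s) fun t => g t)
  map_rel' := by
    have hspine (i j : Fin (p.length + 1)) (h : i.val + 1 = j) :
        T.Adj (p.getVert i) (p.getVert j) := h ▸ p.adj_getVert_succ (by omega)
    have hfirst (i : Fin (p.length + 1)) (h : i.val = 0) (s : Fin a) :
        T.Adj (p.getVert i) (f s) := by
      rw [h, p.getVert_zero]
      exact (f s).2.2
    have hlast (i : Fin (p.length + 1)) (h : i.val + 1 = p.length + 1) (t : Fin b) :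
        T.Adj (p.getVert i) (g t) := by
      rw [Nat.succ.inj h, p.getVert_length]
      exact (g t).2.2
    rintro (i | s | t) (j | s' | t') h
    · exact h.elim (hspine i j) fun h => (hspine j i h).symm
    · exact hfirst i h s'
    · exact hlast i h t'
    · exact (hfirst j h s).symm
    · exact h.elim
    · exact h.elim
    · exact (hlast j h t).symm
    · exact h.elim
    · exact h.elim

variable {p}

theorem doubleStarPathHom_injective (hp : p.IsPath) (hux : u ≠ x) (hu : ¬ IsPendent T u)
    (hx : ¬ IsPendent T x) : Function.Injective (doubleStarPathHom p f g) := by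
  have hpath (i : Fin (p.length + 1)) : ¬ IsPendent T (p.getVert i) :=
    not_isPendent_of_mem_support hp hu hx (p.getVert_mem_support i)
  refine Function.Injective.sumElim (fun i j hij => ?_) (Function.Injective.sumElim
    (Subtype.val_injective.comp f.injective) (Subtype.val_injective.comp g.injective) ?_) ?_
  · exact Fin.ext (hp.getVert_injOn (Nat.le_of_lt_succ i.2) (Nat.le_of_lt_succ j.2) hij)
  · exact fun s t => (disjoint_pendentNeighbors T hux).ne_of_mem (f s).2 (g t).2
  · rintro i (s | t) h
    · exact hpath i (h ▸ (f s).2.1)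
    · exact hpath i (h ▸ (g t).2.1)

theorem doubleStarPathHom_surjective [Finite V] (hT : T.IsTree)
    (hcover : {z | IsPendent T z} ⊆ pendentNeighbors T u ∪ pendentNeighbors T x) :
    Function.Surjective (doubleStarPathHom p f g) := by
  intro w
  by_cases hw : IsPendent T w
  · rcases hcover hw with h | h
    · exact ⟨.inr (.inl (f.symm ⟨w, h⟩)), by simp [doubleStarPathHom]⟩
    · exact ⟨.inr (.inr (g.symm ⟨w, h⟩)), by simp [doubleStarPathHom]⟩
  · obtain ⟨i, rfl, hi⟩ := p.mem_support_iff_exists_getVert.1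
      (mem_support_of_not_isPendent hT hcover hw p)
    exact ⟨.inl ⟨i, Nat.lt_succ_of_le hi⟩, rfl⟩

end Parametrization

theorem exists_iso_doubleStarPath [Finite V] (hT : T.IsTree) (hux : u ≠ x)
    (hu : ¬ IsPendent T u) (hx : ¬ IsPendent T x)
    (hcover : {z | IsPendent T z} ⊆ pendentNeighbors T u ∪ pendentNeighbors T x) :
    ∃ m, Nonempty (doubleStarPath (m + 1) (pendentNeighbors T u).ncard
      (pendentNeighbors T x).ncard ≃g T) := by
  obtain ⟨p, hp⟩ := (hT.connected.preconnected u x).exists_isPath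
  have enum (c : V) : Fin (pendentNeighbors T c).ncard ≃ pendentNeighbors T c :=
    (Finite.equivFinOfCardEq (Nat.card_coe_set_eq _)).symm
  exact ⟨p.length, nonempty_iso_of_bijective_hom (connected_doubleStarPath _ _ _) hT.isAcyclic
    (doubleStarPathHom p (enum u) (enum x))
    ⟨doubleStarPathHom_injective _ _ hp hux hu hx, doubleStarPathHom_surjective _ _ hT hcover⟩⟩

/-! ### The extremal trees -/

theorem IsOutermostHeavy.not_isPendent [Finite V] (h : IsOutermostHeavy T 2 u v) :
    ¬ IsPendent T u :=
  ((two_le_edgeMu_iff h.adj).1 h.le_edgeMu).1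

theorem IsOutermostHeavy.ncard_side_le [Finite V] (h : IsOutermostHeavy T 2 u v) :
    (side T u v).ncard ≤ (pendentNeighbors T u).ncard + 1 := by
  have hsub : side T u v ⊆ insert u (pendentNeighbors T u) := by
    suffices hinter : side T u v ⊆ side T u v ∩ insert u (pendentNeighbors T u) from
      fun c hc => (hinter hc).2
    refine side_subset_of_closed ⟨left_mem_side T u v, Or.inl rfl⟩ fun c d hcd hne hc => ?_
    have hd := mem_side_of_adj hc.1 hcd hne
    refine ⟨hd, ?_⟩
    rcases hc with ⟨-, rfl | hc⟩
    · refine Or.inr ⟨?_, hcd⟩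
      by_contra hpendent
      have hheavy := (two_le_edgeMu_iff hcd).2 ⟨h.not_isPendent, hpendent⟩
      exact h.disjoint.notMem_of_mem_left (a := s(c, d)) ⟨hcd, hheavy⟩ ⟨left_mem_side T c v, hd⟩
    · exact Or.inl (hc.1.eq_of_adj hcd hc.2.symm)
  exact (Set.ncard_le_ncard hsub (Set.toFinite _)).trans (Set.ncard_insert_le _ _)

theorem exists_ne_le_ncard_pendentNeighbors [Finite V] (hT : T.IsTree)
    (hne : (heavyEdges T 2).Nonempty) (hsub : heavyEdges T 2 ⊆ heavyEdges T (a + 1))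
    (hba : b ≤ a + 1) (hunique : a < b → edgeDivision T (a + 1) ≤ 1)
    (hV : a + b + 2 ≤ Nat.card V) :
    ∃ u x, u ≠ x ∧ ¬ IsPendent T u ∧ ¬ IsPendent T x ∧
      a ≤ (pendentNeighbors T u).ncard ∧ b ≤ (pendentNeighbors T x).ncard := by
  obtain ⟨u, v, x, y, huv, hxy, hdisj⟩ := exists_isOutermostHeavy_pair hT.isAcyclic hne
  have hux : u ≠ x := hdisj.ne_of_mem (left_mem_side T u v) (left_mem_side T x y)
  have hle {c d : V} (h : IsOutermostHeavy T 2 c d) :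
      a + 1 ≤ edgeMu T s(c, d) ∧ edgeMu T s(c, d) ≤ (pendentNeighbors T c).ncard + 1 :=
    ⟨(hsub ⟨h.adj, h.le_edgeMu⟩).2, (min_le_left _ _).trans h.ncard_side_le⟩
  have hleu := hle huv
  have hlex := hle hxy
  rcases le_or_gt b (pendentNeighbors T x).ncard with hbx | hbx
  · exact ⟨u, x, hux, huv.not_isPendent, hxy.not_isPendent, by omega, hbx⟩
  rcases le_or_gt b (pendentNeighbors T u).ncard with hbu | hbu
  · exact ⟨x, u, hux.symm, hxy.not_isPendent, huv.not_isPendent, by omega, hbu⟩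
  -- Both edges now have `μ = a + 1`, so they coincide and `T` has only `2 (a + 1)` vertices.
  exfalso
  have hedge : s(u, v) = s(x, y) :=
    (Set.ncard_le_one (Set.toFinite _)).1 (hunique (by omega)) _ ⟨huv.adj, by omega⟩ _
      ⟨hxy.adj, by omega⟩
  obtain ⟨rfl, rfl⟩ := (Sym2.eq_iff.1 hedge).resolve_left fun h => hux h.1
  have := ncard_side_add_ncard_side_swap hT huv.adj
  have := huv.ncard_side_le
  have := hxy.ncard_side_le
  omega

theorem edgeDivisionLE_doubleStarPath (hm : 1 ≤ m) (ha : 1 ≤ a) (hab : a ≤ b) (hba : b ≤ a + 1)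
    (hT : IsTreeWithPendents (m + 1 + (a + b)) (a + b) T) :
    EdgeDivisionLE (m + 1 + (a + b)) T (doubleStarPath (m + 1) a b) := by
  have := hT.finite
  refine (edgeDivisionLE_iff hT.isTree (isTree_doubleStarPath m a b) hT.card_vertices
    (natCard_doubleStarPath _ _ _)).2 fun k hk => ?_
  rcases (Finset.mem_Icc.1 hk).1.eq_or_lt with rfl | (hk : 2 ≤ k)
  · have hT_edges := ncard_edgeSet_add_one hT.isTree
    have hedges := ncard_edgeSet_add_one (isTree_doubleStarPath m a b)
    rw [hT.card_vertices] at hT_edges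
    rw [natCard_doubleStarPath] at hedges
    rw [heavyEdges_one, heavyEdges_one]
    omega
  · have htwo := ncard_heavyEdges_two_add hT.isTree (by rw [hT.card_vertices]; omega)
    have hanti := Set.ncard_le_ncard (heavyEdges_anti T hk) (Set.toFinite _)
    have hle := ncard_heavyEdges_le hT.isTree k
    rw [hT.card_vertices] at htwo hle
    rw [hT.card_pendent] at htwo
    rw [ncard_heavyEdges_doubleStarPath hm ha hab hba hk]
    omega

theorem nonempty_iso_of_le_ncard_pendentNeighbors
    (hT : IsTreeWithPendents (m + 1 + (a + b)) (a + b) T) (hux : u ≠ x)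
    (hu : ¬ IsPendent T u) (hx : ¬ IsPendent T x) (ha : a ≤ (pendentNeighbors T u).ncard)
    (hb : b ≤ (pendentNeighbors T x).ncard) : Nonempty (T ≃g doubleStarPath (m + 1) a b) := by
  have := hT.finite
  have hsub : pendentNeighbors T u ∪ pendentNeighbors T x ⊆ {z | IsPendent T z} :=
    Set.union_subset (fun _ h => h.1) fun _ h => h.1
  have hadd := Set.ncard_union_eq (disjoint_pendentNeighbors T hux)
  have hle := Set.ncard_le_ncard hsub
  rw [hT.card_pendent] at hle
  have hcover := Set.eq_of_subset_of_ncard_le hsub (by rw [hT.card_pendent]; omega)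
  obtain ⟨l, ⟨φ⟩⟩ := exists_iso_doubleStarPath hT.isTree hux hu hx hcover.ge
  obtain rfl : (pendentNeighbors T u).ncard = a := by omega
  obtain rfl : (pendentNeighbors T x).ncard = b := by omega
  have hcard := Nat.card_congr φ.toEquiv
  rw [natCard_doubleStarPath, hT.card_vertices] at hcard
  obtain rfl : l = m := by omega
  exact ⟨φ.symm⟩

theorem nonempty_iso_of_edgeDivisionEq (hm : 1 ≤ m) (ha : 1 ≤ a) (hab : a ≤ b) (hba : b ≤ a + 1)
    (hT : IsTreeWithPendents (m + 1 + (a + b)) (a + b) T)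
    (h : EdgeDivisionEq (m + 1 + (a + b)) T (doubleStarPath (m + 1) a b)) :
    Nonempty (T ≃g doubleStarPath (m + 1) a b) := by
  have := hT.finite
  have hcard (k : ℕ) (hk : 2 ≤ k) :
      (heavyEdges T k).ncard = min m (m + (a + b) + 2 - 2 * k) := by
    rw [← ncard_heavyEdges_doubleStarPath hm ha hab hba hk]
    exact ncard_heavyEdges_eq_of_edgeDivisionEq hT.isTree (isTree_doubleStarPath m a b)
      hT.card_vertices (natCard_doubleStarPath _ _ _) h (by omega)
  have htwo := hcard 2 le_rfl
  have hlevel := hcard (a + 1) (by omega)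
  have hlevel_succ := hcard (a + 1 + 1) (by omega)
  have hsub : heavyEdges T 2 ⊆ heavyEdges T (a + 1) :=
    (Set.eq_of_subset_of_ncard_le (heavyEdges_anti T (by omega)) (by omega)).ge
  have hdiv := ncard_heavyEdges_eq_add T (a + 1)
  obtain ⟨u, x, hux, hu, hx, hau, hbx⟩ := exists_ne_le_ncard_pendentNeighbors hT.isTree
    (Set.nonempty_of_ncard_ne_zero (by omega)) hsub hba (fun _ => by omega)
    (by rw [hT.card_vertices]; omega)
  exact nonempty_iso_of_le_ncard_pendentNeighbors hT hux hu hx hau hbx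

end EdgeDivision

open EdgeDivision

theorem mainTheorem4 (n q : ℕ) (hq : 2 < q) (hqn : q < n - 1) :
    IsTreeWithPendents n q (doubleStarPath (n - q) (q / 2) ((q + 1) / 2)) ∧
    ∀ (V : Type*) (T : SimpleGraph V), IsTreeWithPendents n q T →
      EdgeDivisionLE n T (doubleStarPath (n - q) (q / 2) ((q + 1) / 2)) ∧
      (EdgeDivisionEq n T (doubleStarPath (n - q) (q / 2) ((q + 1) / 2)) ↔
        Nonempty (T ≃g doubleStarPath (n - q) (q / 2) ((q + 1) / 2))) := by
  obtain ⟨m, hm, hn⟩ : ∃ m, 1 ≤ m ∧ n - q = m + 1 := ⟨n - q - 1, by omega, by omega⟩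
  rw [hn]
  generalize ha : q / 2 = a, hb : (q + 1) / 2 = b
  obtain rfl : q = a + b := by omega
  obtain rfl : n = m + 1 + (a + b) := by omega
  refine ⟨isTreeWithPendents_doubleStarPath hm (by omega) (by omega), fun V T hT => ⟨?_, ?_, ?_⟩⟩
  · exact edgeDivisionLE_doubleStarPath hm (by omega) (by omega) (by omega) hT
  · exact nonempty_iso_of_edgeDivisionEq hm (by omega) (by omega) (by omega) hT
  · rintro ⟨φ⟩ i -
    exact edgeDivision_eq_of_iso φ i
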